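/- **Setting.** A function $\sigma:\mathbb R\to\mathbb R$ is called Tauber–Wiener if for all $a<b$, all $\varepsilon>0$ and all $f\in C([a,b])$ there are $N\in\mathbb N$ and $c_i,\lambda_i,\theta_i\in\mathbb R$ with $\bigl|f(x)-\sum_{i=1}^N c_i\,\sigma(\lambda_i x+\theta_i)\bigr|<\varepsilon$ for all $x\in[a,b]$ (continuity of $\sigma$ is not required). Let $\Omega_W$ and $\Omega_U$ be non-empty compact subsets of real Banach spaces $\mathcal A$ and $\mathcal U$, let $\Omega_V\subset\mathbb R^n$ be compact, and let $W\subset C(\Omega_W)$ and $U\subset C(\Omega_U)$ be compact (all function spaces are real and carry the supremum norm). Put $V=C(\Omega_V)$. For every $\alpha\in W$ let $G[\alpha]:U\to V$ be a continuous, not necessarily linear, operator, and let $\alpha\mapsto G[\alpha]$ be continuous from $W$ to $C(U,V)$ with the supremum norm. A *MONet* with activation $\sigma$ is a map $$\mathrm{MONet}[\alpha][u](x)=\sum_{k=1}^N\sum_{i=1}^M\tau_k(x)\,b_{ki}(u)\,L_{ki}(\alpha),$$ $$\tau_k(x)=\sigma(\omega_k\cdot x+\zeta_k),\quad b_{ki}(u)=\sigma\Bigl(\sum_{l=1}^m\xi_{kil}\,u(x_l)+\theta_{ki}\Bigr),\quad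 L_{ki}(\alpha)=\sum_{j=1}^P c_{kij}\,\sigma\Bigl(\sum_{h=1}^p\varphi_{kijh}\,\alpha(z_h)+\rho_{kij}\Bigr),$$ with positive integers $N,M,P,m,p$, real constants $c_{kij},\zeta_k,\xi_{kil},\theta_{ki},\varphi_{kijh},\rho_{kij}$, vectors $\omega_k\in\mathbb R^n$ and sensor points $x_l\in\Omega_U$, $z_h\in\Omega_W$. An *MNO with shallow components* is a map $$\mathrm{MNO}[\alpha][u](x)=\sum_{q=1}^{Q} l_q(\alpha)\sum_{k=1}^{H^{(q)}}b_{qk}(u)\,\tau_{qk}(x),$$ $$l_q(\alpha)=\sum_{j=1}^{J} c_{qj}\,\sigma\Bigl(\sum_{h=1}^p\varphi_{qjh}\,\alpha(z_h)+\rho_{qj}\Bigr),\quad b_{qk}(u)=\sigma\Bigl(\sum_{l=1}^m\xi_{qkl}\,u(x_l)+\theta_{qk}\Bigr),\quad \tau_{qk}(x)=\sigma(\omega_{qk}\cdot x+\zeta_{qk}),$$ with positive integers $Q,H^{(q)},J,m,p$, real constants, vectors $\omega_{qk}\in\mathbb R^n$ and sensor points $x_l\in\Omega_U$, $z_h\in\Omega_W$.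 Both networks use $\alpha$ and $u$ only through the discretizations $\boldsymbol\alpha=(\alpha(z_h))_{h=1}^p$ and $\mathbf u=(u(x_l))_{l=1}^m$. **Theorem 3.1 (Universal Approximation Theorem for Multiple Operators in $L^\infty$).** There are sequences of points $z_1,z_2,\dots\in\Omega_W$, depending only on $W$ (and its domain $\Omega_W$), and $x_1,x_2,\dots\in\Omega_U$, depending only on $U$ (and its domain $\Omega_U$), such that for all $n$, $\Omega_V$ and $G$ as above, every Tauber–Wiener function $\sigma$ and every $\varepsilon>0$ there exist a MONet $\mathcal N$ with activation $\sigma$, and also an MNO $\mathcal N$ with shallow components and activation $\sigma$, each with sensor points $z_1,\dots,z_p$ and $x_1,\dots,x_m$ for some $p$ and $m$, such that $$\sup_{\alpha\in W,\;u\in U,\;x\in\Omega_V}\bigl|G[\alpha][u](x)-\mathcal N[\boldsymbol\alpha][\mathbf u](x)\bigr|<\varepsilon .$$ -/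

import Mathlib

open TopologicalSpace

noncomputable section

/-- Tauber–Wiener functions: on every compact interval, every continuous function is a uniform
limit of finite linear combinations of `x ↦ σ (w * x + θ)`. No continuity of `σ` is required. -/
def IsTauberWiener (σ : ℝ → ℝ) : Prop :=
  ∀ a b : ℝ, a < b → ∀ ε : ℝ, 0 < ε → ∀ f : ℝ → ℝ, ContinuousOn f (Set.Icc a b) →
    ∃ (N : ℕ) (c w θ : Fin N → ℝ),
      ∀ x ∈ Set.Icc a b, |f x - ∑ i, c i * σ (w i * x + θ i)| < ε

/-- The sizes, weights and sensor points of a MONet network. `S` is the domain of the parameter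
functions `α`, `T` the domain of the input functions `u`, and the output functions live on `ℝⁿ`. -/
structure MONet (S T : Type*) (n : ℕ) where
  (N M P m p : ℕ)
  N_pos : 0 < N
  M_pos : 0 < M
  P_pos : 0 < P
  m_pos : 0 < m
  p_pos : 0 < p
  c : Fin N → Fin M → Fin P → ℝ
  ζ : Fin N → ℝ
  ξ : Fin N → Fin M → Fin m → ℝ
  φ : Fin N → Fin M → Fin P → Fin p → ℝ
  ρ : Fin N → Fin M → Fin P → ℝ
  θ : Fin N → Fin M → ℝ
  ω : Fin N → EuclideanSpace ℝ (Fin n)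
  x : Fin m → T
  z : Fin p → S

namespace MONet

variable {S T : Type*} [TopologicalSpace S] [TopologicalSpace T] {n : ℕ}

/-- `τ_k(y) = σ(ω_k · y + ζ_k)`. -/
def τ (A : MONet S T n) (σ : ℝ → ℝ) (k : Fin A.N) (y : EuclideanSpace ℝ (Fin n)) : ℝ :=
  σ (inner ℝ (A.ω k) y + A.ζ k)

/-- `b_{ki}(u) = σ(∑_l ξ_{kil} u(x_l) + θ_{ki})`. -/
def b (A : MONet S T n) (σ : ℝ → ℝ) (k : Fin A.N) (i : Fin A.M) (u : C(T, ℝ)) : ℝ :=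
  σ (∑ l, A.ξ k i l * u (A.x l) + A.θ k i)

/-- `L_{ki}(α) = ∑_j c_{kij} σ(∑_h φ_{kijh} α(z_h) + ρ_{kij})`. -/
def L (A : MONet S T n) (σ : ℝ → ℝ) (k : Fin A.N) (i : Fin A.M) (α : C(S, ℝ)) : ℝ :=
  ∑ j, A.c k i j * σ (∑ h, A.φ k i j h * α (A.z h) + A.ρ k i j)

/-- `MONet[α][u](y) = ∑_k ∑_i τ_k(y) b_{ki}(u) L_{ki}(α)` with activation function `σ`. -/
def eval (A : MONet S T n) (σ : ℝ → ℝ) (α : C(S, ℝ)) (u : C(T, ℝ))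
    (y : EuclideanSpace ℝ (Fin n)) : ℝ :=
  ∑ k, ∑ i, A.τ σ k y * A.b σ k i u * A.L σ k i α

end MONet

/-- The sizes, weights and sensor points of an MNO network whose components `l_q`, `b_{qk}`,
`τ_{qk}` are shallow networks of the same form as in a MONet network. The outer sum has `Q` terms,
its `q`-th inner sum has `H q` terms, and each `l_q` has `J` neurons. -/
structure ShallowMNO (S T : Type*) (n : ℕ) where
  Q : ℕ
  Q_pos : 0 < Q
  H : Fin Q → ℕ
  H_pos : ∀ q, 0 < H q
  (J m p : ℕ)
  J_pos : 0 < J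
  m_pos : 0 < m
  p_pos : 0 < p
  c : Fin Q → Fin J → ℝ
  φ : Fin Q → Fin J → Fin p → ℝ
  ρ : Fin Q → Fin J → ℝ
  ξ : (q : Fin Q) → Fin (H q) → Fin m → ℝ
  θ : (q : Fin Q) → Fin (H q) → ℝ
  ω : (q : Fin Q) → Fin (H q) → EuclideanSpace ℝ (Fin n)
  ζ : (q : Fin Q) → Fin (H q) → ℝ
  x : Fin m → T
  z : Fin p → S

namespace ShallowMNO

variable {S T : Type*} [TopologicalSpace S] [TopologicalSpace T] {n : ℕ}

/-- `l_q(α) = ∑_j c_{qj} σ(∑_h φ_{qjh} α(z_h) + ρ_{qj})`. -/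
def l (B : ShallowMNO S T n) (σ : ℝ → ℝ) (q : Fin B.Q) (α : C(S, ℝ)) : ℝ :=
  ∑ j, B.c q j * σ (∑ h, B.φ q j h * α (B.z h) + B.ρ q j)

/-- `b_{qk}(u) = σ(∑_l ξ_{qkl} u(x_l) + θ_{qk})`. -/
def b (B : ShallowMNO S T n) (σ : ℝ → ℝ) (q : Fin B.Q) (k : Fin (B.H q)) (u : C(T, ℝ)) : ℝ :=
  σ (∑ l, B.ξ q k l * u (B.x l) + B.θ q k)

/-- `τ_{qk}(y) = σ(ω_{qk} · y + ζ_{qk})`. -/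
def τ (B : ShallowMNO S T n) (σ : ℝ → ℝ) (q : Fin B.Q) (k : Fin (B.H q))
    (y : EuclideanSpace ℝ (Fin n)) : ℝ :=
  σ (inner ℝ (B.ω q k) y + B.ζ q k)

/-- `MNO[α][u](y) = ∑_q l_q(α) ∑_k b_{qk}(u) τ_{qk}(y)` with activation function `σ`. -/
def eval (B : ShallowMNO S T n) (σ : ℝ → ℝ) (α : C(S, ℝ)) (u : C(T, ℝ))
    (y : EuclideanSpace ℝ (Fin n)) : ℝ :=
  ∑ q, B.l σ q α * ∑ k, B.b σ q k u * B.τ σ q k y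

end ShallowMNO

/-- The supremum norm of a real function of three variables, with value `∞` if it is unbounded. -/
def supNorm₃ {X Y Z : Type*} (f : X → Y → Z → ℝ) : ENNReal :=
  ⨆ (a : X) (b : Y) (c : Z), ‖f a b c‖ₑ

end

/-! The operator is a single continuous function `F (α, u, y) = G[α][u](y)` on the compact space `W
× U × Ω_V`. Sampling `α` and `u` along dense sequences, together with the inner products of `y`,
separates the points of this space. The exponentials of linear combinations of these coordinates are
closed under multiplication, so by Stone–Weierstrass their span is dense (`dense_span_exp`). Each
such exponential splits into three factors, in `α`, `u` and `y` alone. The exponent of each factor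
is bounded, so the Tauber–Wiener property replaces `exp` by combinations of `σ`, which may be
discontinuous (`IsTauberWiener.uniformlyApproximable`). The resulting finite sum of weighted triple
products of ridge functions is both a MONet and an MNO. -/

/-- `f` is a uniform limit of elements of the function space `V`. -/
def UniformlyApproximable {X : Type*} (V : Submodule ℝ (X → ℝ)) (f : X → ℝ) : Prop :=
  ∀ ε : ℝ, 0 < ε → ∃ g ∈ V, ∀ x, |f x - g x| < ε

namespace UniformlyApproximable

variable {X : Type*} {V V' : Submodule ℝ (X → ℝ)} {f f' : X → ℝ}

theorem zero : UniformlyApproximable V 0 := fun ε hε => ⟨0, V.zero_mem, fun _ => by simpa using hε⟩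

theorem add (h : UniformlyApproximable V f) (h' : UniformlyApproximable V f') :
    UniformlyApproximable V (f + f') := by
  intro ε hε
  obtain ⟨g, hg, hfg⟩ := h (ε / 2) (half_pos hε)
  obtain ⟨g', hg', hfg'⟩ := h' (ε / 2) (half_pos hε)
  refine ⟨g + g', V.add_mem hg hg', fun x => ?_⟩
  have h1 := abs_lt.1 (hfg x)
  have h2 := abs_lt.1 (hfg' x)
  simp only [Pi.add_apply, abs_lt]
  constructor <;> linarith

theorem smul (c : ℝ) (h : UniformlyApproximable V f) : UniformlyApproximable V (c • f) := by
  intro ε hε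
  have hc : 0 < |c| + 1 := by positivity
  obtain ⟨g, hg, hfg⟩ := h (ε / (|c| + 1)) (div_pos hε hc)
  refine ⟨c • g, V.smul_mem c hg, fun x => ?_⟩
  simp only [Pi.smul_apply, smul_eq_mul]
  rw [← mul_sub, abs_mul]
  have h1 := (lt_div_iff₀ hc).1 (hfg x)
  nlinarith [abs_nonneg (f x - g x)]

/-- A uniform limit of uniformly approximable functions is uniformly approximable. -/
theorem of_forall_exists (h : ∀ ε : ℝ, 0 < ε → ∃ g, UniformlyApproximable V g ∧
    ∀ x, |f x - g x| < ε) : UniformlyApproximable V f := by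
  intro ε hε
  obtain ⟨g, hg, hfg⟩ := h (ε / 2) (half_pos hε)
  obtain ⟨k, hk, hgk⟩ := hg (ε / 2) (half_pos hε)
  refine ⟨k, hk, fun x => ?_⟩
  have h1 := abs_lt.1 (hfg x)
  have h2 := abs_lt.1 (hgk x)
  rw [abs_lt]
  constructor <;> linarith

/-- Products of bounded functions can be approximated factor by factor. -/
theorem mul (h : UniformlyApproximable V f) (h' : UniformlyApproximable V' f')
    {C C' : ℝ} (hf : ∀ x, |f x| ≤ C) (hf' : ∀ x, |f' x| ≤ C') :
    UniformlyApproximable (V * V') (f * f') := by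
  intro ε hε
  -- As `δ ≤ 1`, the approximant `g'` is bounded by `|C'| + 1`, so the product error is at most `|C|
  -- * δ + δ * (|C'| + 1) = δ * D`.
  set D : ℝ := |C| + |C'| + 1 with hD
  have hDpos : 0 < D := by positivity
  set δ : ℝ := min 1 (ε / (2 * D))
  have hδ : 0 < δ := lt_min one_pos (by positivity)
  have hδD : δ * D ≤ ε / 2 := by
    calc δ * D ≤ ε / (2 * D) * D := by gcongr; exact min_le_right _ _
      _ = ε / 2 := by field_simp
  obtain ⟨g, hg, hfg⟩ := h δ hδ
  obtain ⟨g', hg', hfg'⟩ := h' δ hδ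
  refine ⟨g * g', Submodule.mul_mem_mul hg hg', fun x => ?_⟩
  have hg'x : |g' x| ≤ |C'| + 1 := by
    have h1 : |g' x| ≤ |f' x| + |f' x - g' x| := by
      have := abs_sub_abs_le_abs_sub (g' x) (f' x)
      rw [abs_sub_comm] at this
      linarith
    have h2 : δ ≤ 1 := min_le_left _ _
    linarith [hf' x, le_abs_self C', hfg' x]
  have hfx : |f x| ≤ |C| := (hf x).trans (le_abs_self C)
  calc |(f * f') x - (g * g') x| = |f x * (f' x - g' x) + (f x - g x) * g' x| := by
        simp only [Pi.mul_apply]; ring_nf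
    _ ≤ |f x| * |f' x - g' x| + |f x - g x| * |g' x| := by
        rw [← abs_mul, ← abs_mul]; exact abs_add_le _ _
    _ ≤ |C| * δ + δ * (|C'| + 1) := by
        gcongr
        · exact (hfg' x).le
        · exact (hfg x).le
    _ = δ * D := by rw [hD]; ring
    _ < ε := by linarith

end UniformlyApproximable

/-! ### Density of products of ridge functions -/

/-- The functions `x ↦ σ (ℓ a x + ρ)` for a linear family `ℓ` of functions. -/
def ridgeFunctions {X E : Type*} [TopologicalSpace X] [AddCommGroup E] [Module ℝ E]
    (σ : ℝ → ℝ) (ℓ : E →ₗ[ℝ] C(X, ℝ)) : Set (X → ℝ) :=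
  Set.range fun q : E × ℝ => fun x => σ (ℓ q.1 x + q.2)

section Density

variable {X : Type*} [TopologicalSpace X] [CompactSpace X]
  {E E₁ E₂ E₃ : Type*} [AddCommGroup E] [Module ℝ E] [AddCommGroup E₁] [Module ℝ E₁]
  [AddCommGroup E₂] [Module ℝ E₂] [AddCommGroup E₃] [Module ℝ E₃]

theorem abs_exp_le (ℓ : E →ₗ[ℝ] C(X, ℝ)) (a : E) (x : X) :
    |Real.exp (ℓ a x)| ≤ Real.exp ‖ℓ a‖ := by
  rw [Real.abs_exp]
  exact Real.exp_le_exp.2 ((le_abs_self _).trans ((ℓ a).norm_coe_le_norm x))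

/-- `ℓ a` takes values in a compact interval, where `exp` is approximated by neurons in one
variable; linearity of `ℓ` absorbs the inner weight, `w * ℓ a x = ℓ (w • a) x`. -/
theorem IsTauberWiener.uniformlyApproximable_exp {σ : ℝ → ℝ} (hσ : IsTauberWiener σ)
    (ℓ : E →ₗ[ℝ] C(X, ℝ)) (a : E) :
    UniformlyApproximable (Submodule.span ℝ (ridgeFunctions σ ℓ))
      (fun x => Real.exp (ℓ a x)) := by
  intro ε hε
  -- The margin 1 keeps the interval nondegenerate when `ℓ a = 0`.
  obtain ⟨N, c, w, θ, h⟩ := hσ (-‖ℓ a‖ - 1) (‖ℓ a‖ + 1) (by linarith [norm_nonneg (ℓ a)]) ε hε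
    Real.exp Real.continuous_exp.continuousOn
  refine ⟨∑ i, c i • fun x => σ (ℓ (w i • a) x + θ i),
    Submodule.sum_mem _ fun i _ => Submodule.smul_mem _ _
      (Submodule.subset_span ⟨(w i • a, θ i), rfl⟩), fun x => ?_⟩
  have hx := abs_le.1 ((ℓ a).norm_coe_le_norm x)
  simpa using h (ℓ a x) ⟨by linarith, by linarith⟩

/-- Exponentials of a point-separating linear family span a dense subspace. -/
theorem dense_span_exp (ℓ : E →ₗ[ℝ] C(X, ℝ))
    (hsep : ∀ x y : X, (∀ a, ℓ a x = ℓ a y) → x = y) (F : C(X, ℝ)) :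
    UniformlyApproximable
      (Submodule.span ℝ (Set.range fun a : E => fun x => Real.exp (ℓ a x))) F := by
  let e : E → C(X, ℝ) := fun a => ⟨fun x => Real.exp (ℓ a x), by fun_prop⟩
  -- Since the exponentials form a monoid, the algebra they generate is just their linear span.
  let M : Submonoid C(X, ℝ) :=
    { carrier := Set.range e
      one_mem' := ⟨0, by ext x; simp [e]⟩
      mul_mem' := by
        rintro _ _ ⟨a, rfl⟩ ⟨b, rfl⟩
        exact ⟨a + b, by ext x; simp [e, Real.exp_add]⟩ }
  have hM : (Algebra.adjoin ℝ (M : Set C(X, ℝ))).SeparatesPoints := by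
    intro x y hxy
    by_contra! hcon
    refine hxy (hsep x y fun a => Real.exp_injective ?_)
    exact hcon (e a) ⟨e a, Algebra.subset_adjoin ⟨a, rfl⟩, rfl⟩
  intro ε hε
  obtain ⟨⟨g, hg⟩, hFg⟩ :=
    ContinuousMap.exists_mem_subalgebra_near_continuousMap_of_separatesPoints _ hM F ε hε
  rw [← Subalgebra.mem_toSubmodule, Algebra.adjoin_eq_span, Submonoid.closure_eq] at hg
  refine ⟨g, ?_, fun x => ?_⟩
  · have h := Submodule.mem_map_of_mem (f := ContinuousMap.coeFnLinearMap ℝ (α := X) (M := ℝ)) hg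
    rw [Submodule.map_span] at h
    refine Submodule.span_mono ?_ h
    rintro _ ⟨_, ⟨a, rfl⟩, rfl⟩
    exact ⟨a, rfl⟩
  · rw [abs_sub_comm]
    exact ((g - F).norm_coe_le_norm x).trans_lt hFg

open scoped Pointwise in
/-- Products of three ridge functions, one from each of three linear families which jointly
separate points, span a uniformly dense space. -/
theorem IsTauberWiener.uniformlyApproximable {σ : ℝ → ℝ} (hσ : IsTauberWiener σ)
    (ℓ₁ : E₁ →ₗ[ℝ] C(X, ℝ)) (ℓ₂ : E₂ →ₗ[ℝ] C(X, ℝ)) (ℓ₃ : E₃ →ₗ[ℝ] C(X, ℝ))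
    (hsep : ∀ x y : X, (∀ a, ℓ₁ a x = ℓ₁ a y) → (∀ a, ℓ₂ a x = ℓ₂ a y) →
      (∀ a, ℓ₃ a x = ℓ₃ a y) → x = y) (F : C(X, ℝ)) :
    UniformlyApproximable (Submodule.span ℝ
      (ridgeFunctions σ ℓ₁ * ridgeFunctions σ ℓ₂ * ridgeFunctions σ ℓ₃)) F := by
  rw [← Submodule.span_mul_span, ← Submodule.span_mul_span]
  refine .of_forall_exists fun ε hε => ?_
  obtain ⟨g, hg, hFg⟩ := dense_span_exp (ℓ₁.coprod (ℓ₂.coprod ℓ₃)) (fun x y h =>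
    hsep x y (fun a => by simpa using h (a, 0, 0)) (fun a => by simpa using h (0, a, 0))
      (fun a => by simpa using h (0, 0, a))) F ε hε
  refine ⟨g, ?_, hFg⟩
  clear hFg
  induction hg using Submodule.span_induction with
  | zero => exact .zero
  | add _ _ _ _ h h' => exact h.add h'
  | smul c _ _ h => exact h.smul c
  | mem _ h =>
    obtain ⟨⟨a, b, c⟩, rfl⟩ := h
    have h12 := (hσ.uniformlyApproximable_exp ℓ₁ a).mul (hσ.uniformlyApproximable_exp ℓ₂ b)
      (abs_exp_le ℓ₁ a) (abs_exp_le ℓ₂ b)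
    have h123 := h12.mul (hσ.uniformlyApproximable_exp ℓ₃ c)
      (C := Real.exp ‖ℓ₁ a‖ * Real.exp ‖ℓ₂ b‖) (fun x => by
        rw [Pi.mul_apply, abs_mul]
        exact mul_le_mul (abs_exp_le ℓ₁ a x) (abs_exp_le ℓ₂ b x) (abs_nonneg _)
          (Real.exp_pos _).le) (abs_exp_le ℓ₃ c)
    convert h123 using 1
    ext x
    simp [Real.exp_add, mul_assoc]

end Density

/-! ### From spans to finite networks -/

open scoped Pointwise in
/-- An element of the span of the products of three ridge functions is a sum of at least one
weighted product. -/
theorem exists_eq_sum_of_mem_span_ridgeFunctions {X E₁ E₂ E₃ : Type*} [TopologicalSpace X]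
    [AddCommGroup E₁] [Module ℝ E₁] [AddCommGroup E₂] [Module ℝ E₂] [AddCommGroup E₃]
    [Module ℝ E₃] {σ : ℝ → ℝ}
    {ℓ₁ : E₁ →ₗ[ℝ] C(X, ℝ)} {ℓ₂ : E₂ →ₗ[ℝ] C(X, ℝ)} {ℓ₃ : E₃ →ₗ[ℝ] C(X, ℝ)} {g : X → ℝ}
    (hg : g ∈ Submodule.span ℝ
      (ridgeFunctions σ ℓ₁ * ridgeFunctions σ ℓ₂ * ridgeFunctions σ ℓ₃)) :
    ∃ (N : ℕ) (c : Fin (N + 1) → ℝ) (q : Fin (N + 1) → (E₁ × ℝ) × (E₂ × ℝ) × (E₃ × ℝ)),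
      ∀ x, g x = ∑ i, c i * (σ (ℓ₁ (q i).1.1 x + (q i).1.2) *
        σ (ℓ₂ (q i).2.1.1 x + (q i).2.1.2) * σ (ℓ₃ (q i).2.2.1 x + (q i).2.2.2)) := by
  obtain ⟨N, c, s, rfl⟩ := Submodule.mem_span_set'.1 hg
  have hs (i : Fin N) : ∃ q : (E₁ × ℝ) × (E₂ × ℝ) × (E₃ × ℝ), ∀ x, (s i : X → ℝ) x =
      σ (ℓ₁ q.1.1 x + q.1.2) * σ (ℓ₂ q.2.1.1 x + q.2.1.2) * σ (ℓ₃ q.2.2.1 x + q.2.2.2) := by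
    obtain ⟨_, ⟨_, ⟨q₁, rfl⟩, _, ⟨q₂, rfl⟩, rfl⟩, _, ⟨q₃, rfl⟩, h⟩ := (s i).2
    exact ⟨(q₁, q₂, q₃), fun x => by rw [← h]; rfl⟩
  choose q hq using hs
  -- A zero term is prepended because networks must have at least one summand.
  refine ⟨N, Fin.cons 0 c, Fin.cons 0 q, fun x => ?_⟩
  simp [Fin.sum_univ_succ, hq]

/-- A supremum of values below `ε / 2` may attain `ε / 2`; halving restores strictness. -/
theorem supNorm₃_lt_ofReal {X Y Z : Type*} {f : X → Y → Z → ℝ} {ε : ℝ} (hε : 0 < ε)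
    (h : ∀ a b c, |f a b c| < ε / 2) : supNorm₃ f < ENNReal.ofReal ε := by
  refine lt_of_le_of_lt (b := ENNReal.ofReal (ε / 2))
    (iSup_le fun a => iSup_le fun b => iSup_le fun c => ?_)
    ((ENNReal.ofReal_lt_ofReal_iff hε).2 (half_lt_self hε))
  rw [← ofReal_norm, Real.norm_eq_abs]
  exact ENNReal.ofReal_le_ofReal (h a b c).le

/-- A common length for finitely many finitely supported coefficient sequences. -/
theorem exists_forall_sum_eq_sum_fin {ι : Type*} [Fintype ι] (a : ι → ℕ →₀ ℝ) :
    ∃ p : ℕ, 0 < p ∧ ∀ i (v : ℕ → ℝ), ((a i).sum fun h r => r * v h) = ∑ h : Fin p, a i h * v h := by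
  obtain ⟨p, hp⟩ := (Finset.univ.biUnion fun i => (a i).support).exists_nat_subset_range
  refine ⟨p + 1, p.succ_pos, fun i v => ?_⟩
  rw [Fin.sum_univ_eq_sum_range (fun h => a i h * v h)]
  refine Finsupp.sum_of_support_subset _ (fun h hh => ?_) _ (by simp)
  have := Finset.mem_range.1 (hp (Finset.mem_biUnion.2 ⟨i, Finset.mem_univ i, hh⟩))
  exact Finset.mem_range.2 (by omega)

theorem theorem3p1
    {𝒜 : Type*} [NormedAddCommGroup 𝒜] [NormedSpace ℝ 𝒜] [CompleteSpace 𝒜]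
    {𝒰 : Type*} [NormedAddCommGroup 𝒰] [NormedSpace ℝ 𝒰] [CompleteSpace 𝒰] :
    -- sensor sequences: `z` depends only on `W` (with its domain), `x` only on `U`
    ∃ (z : (ΩW : NonemptyCompacts 𝒜) → Set C(ΩW, ℝ) → ℕ → ΩW)
      (x : (ΩU : NonemptyCompacts 𝒰) → Set C(ΩU, ℝ) → ℕ → ΩU),
      ∀ (ΩW : NonemptyCompacts 𝒜) (W : Set C(ΩW, ℝ)) (_ : IsCompact W)
        (ΩU : NonemptyCompacts 𝒰) (U : Set C(ΩU, ℝ)) (_ : IsCompact U)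
        (n : ℕ) (ΩV : Set (EuclideanSpace ℝ (Fin n))) (_ : IsCompact ΩV)
        (σ : ℝ → ℝ) (_ : IsTauberWiener σ)
        (G : W → U → C(ΩV, ℝ)) (hG : ∀ α : W, Continuous (G α))
        (_ : Continuous fun α : W => (⟨G α, hG α⟩ : C(U, C(ΩV, ℝ))))
        (ε : ℝ) (_ : 0 < ε),
        (∃ A : MONet ΩW ΩU n,
          (∀ h, A.z h = z ΩW W h) ∧ (∀ l, A.x l = x ΩU U l) ∧
          supNorm₃ (fun (α : W) (u : U) (y : ΩV) => G α u y - A.eval σ α u y)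
            < ENNReal.ofReal ε) ∧
        (∃ B : ShallowMNO ΩW ΩU n,
          (∀ h, B.z h = z ΩW W h) ∧ (∀ l, B.x l = x ΩU U l) ∧
          supNorm₃ (fun (α : W) (u : U) (y : ΩV) => G α u y - B.eval σ α u y)
            < ENNReal.ofReal ε) := by
  -- Any dense sequence in the domain serves, since it determines every continuous function.
  refine ⟨fun ΩW _ => denseSeq ΩW, fun ΩU _ => denseSeq ΩU, ?_⟩
  intro ΩW W hW ΩU U hU n ΩV hV σ hσ G hG hGc ε hε
  have : CompactSpace W := isCompact_iff_compactSpace.1 hW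
  have : CompactSpace U := isCompact_iff_compactSpace.1 hU
  have : CompactSpace ΩV := isCompact_iff_compactSpace.1 hV
  set z := denseSeq ΩW
  set x := denseSeq ΩU
  let F : C(W × U × ΩV, ℝ) := ⟨fun t => G t.1 t.2.1 t.2.2, by
    have h1 : Continuous fun t : W × U × ΩV => G t.1 t.2.1 :=
      (hGc.comp continuous_fst).eval (continuous_fst.comp continuous_snd)
    exact h1.eval (continuous_snd.comp continuous_snd)⟩
  let eW (h : ℕ) : C(W × U × ΩV, ℝ) :=
    ⟨fun t => (t.1 : C(ΩW, ℝ)) (z h), by fun_prop⟩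
  let eU (l : ℕ) : C(W × U × ΩV, ℝ) :=
    ⟨fun t => (t.2.1 : C(ΩU, ℝ)) (x l), by fun_prop⟩
  let ℓW := Finsupp.linearCombination ℝ eW
  let ℓU := Finsupp.linearCombination ℝ eU
  let ℓV : EuclideanSpace ℝ (Fin n) →ₗ[ℝ] C(W × U × ΩV, ℝ) :=
    { toFun := fun ω => ⟨fun t => inner ℝ ω (t.2.2 : EuclideanSpace ℝ (Fin n)), by fun_prop⟩
      map_add' := fun ω ω' => by ext t; exact inner_add_left ω ω' _
      map_smul' := fun r ω => by ext t; exact real_inner_smul_left ω _ r }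
  have hℓW (a : ℕ →₀ ℝ) (t) : ℓW a t = a.sum fun h r => r * (t.1 : C(ΩW, ℝ)) (z h) := by
    simp [ℓW, eW, Finsupp.linearCombination_apply, Finsupp.sum]
  have hℓU (a : ℕ →₀ ℝ) (t) : ℓU a t = a.sum fun l r => r * (t.2.1 : C(ΩU, ℝ)) (x l) := by
    simp [ℓU, eU, Finsupp.linearCombination_apply, Finsupp.sum]
  obtain ⟨g, hg, hFg⟩ := hσ.uniformlyApproximable ℓW ℓU ℓV (by
    rintro ⟨α, u, y⟩ ⟨α', u', y'⟩ hα hu hy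
    refine Prod.ext (Subtype.ext ?_) (Prod.ext (Subtype.ext ?_) (Subtype.ext ?_))
    · refine DFunLike.coe_injective ((denseRange_denseSeq ΩW).equalizer
        (map_continuous _) (map_continuous _) (funext fun h => ?_))
      simpa [hℓW] using hα (Finsupp.single h 1)
    · refine DFunLike.coe_injective ((denseRange_denseSeq ΩU).equalizer
        (map_continuous _) (map_continuous _) (funext fun l => ?_))
      simpa [hℓU] using hu (Finsupp.single l 1)
    · exact ext_inner_left ℝ hy) F (ε / 2) (half_pos hε)
  obtain ⟨N, c, q, hgq⟩ := exists_eq_sum_of_mem_span_ridgeFunctions hg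
  obtain ⟨p, hp, hqp⟩ := exists_forall_sum_eq_sum_fin fun i => (q i).1.1
  obtain ⟨m, hm, hqm⟩ := exists_forall_sum_eq_sum_fin fun i => (q i).2.1.1
  have hkey (α : W) (u : U) (y : ΩV) : |G α u y - ∑ i, c i *
      (σ (∑ h : Fin p, (q i).1.1 h * (α : C(ΩW, ℝ)) (z h) + (q i).1.2) *
        σ (∑ l : Fin m, (q i).2.1.1 l * (u : C(ΩU, ℝ)) (x l) + (q i).2.1.2) *
        σ (inner ℝ (q i).2.2.1 (y : EuclideanSpace ℝ (Fin n)) + (q i).2.2.2))| < ε / 2 := by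
    have h := hFg (α, u, y)
    simp only [hgq, hℓW, hℓU, hqp, hqm] at h
    exact h
  constructor
  · refine ⟨{ N := N + 1, M := 1, P := 1, m := m, p := p
              N_pos := N.succ_pos, M_pos := one_pos, P_pos := one_pos, m_pos := hm, p_pos := hp
              c := fun i _ _ => c i
              ζ := fun i => (q i).2.2.2
              ξ := fun i _ l => (q i).2.1.1 l
              φ := fun i _ _ h => (q i).1.1 h
              ρ := fun i _ _ => (q i).1.2
              θ := fun i _ => (q i).2.1.2
              ω := fun i => (q i).2.2.1
              x := fun l => x l
              z := fun h => z h }, fun _ => rfl, fun _ => rfl,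
      supNorm₃_lt_ofReal hε fun α u y => ?_⟩
    convert hkey α u y using 3
    simp only [MONet.eval, MONet.τ, MONet.b, MONet.L, Finset.univ_unique, Finset.sum_singleton]
    exact Finset.sum_congr rfl fun i _ => by ring
  · refine ⟨{ Q := N + 1, Q_pos := N.succ_pos, H := fun _ => 1, H_pos := fun _ => one_pos
              J := 1, m := m, p := p, J_pos := one_pos, m_pos := hm, p_pos := hp
              c := fun i _ => c i
              φ := fun i _ h => (q i).1.1 h
              ρ := fun i _ => (q i).1.2
              ξ := fun i _ l => (q i).2.1.1 l
              θ := fun i _ => (q i).2.1.2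
              ω := fun i _ => (q i).2.2.1
              ζ := fun i _ => (q i).2.2.2
              x := fun l => x l
              z := fun h => z h }, fun _ => rfl, fun _ => rfl,
      supNorm₃_lt_ofReal hε fun α u y => ?_⟩
    convert hkey α u y using 3
    simp only [ShallowMNO.eval, ShallowMNO.τ, ShallowMNO.b, ShallowMNO.l, Finset.univ_unique,
      Finset.sum_singleton]
    exact Finset.sum_congr rfl fun i _ => by ring
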